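/- Let $G=(V,E)$ be a finite undirected graph (parallel edges and loops allowed), with edge costs $c\colon E\to\mathbb{Q}_+$, edge capacities $u\colon E\to\mathbb{Z}_+$, a terminal set $T\subseteq V$ and requirements $r\colon T\to\mathbb{Z}_+$. For a positive integer $k$, a number is called $1/k$-fractional if its product with $k$ is an integer, and a vector or function is $1/k$-fractional if all of its entries are. A biset is a pair $\hat X=(X,X^+)$ with $X\subseteq X^+\subseteq V$; $\delta(\hat X)$ is the set of edges with one end node in $X$ and the other in $V\setminus X^+$, and $\delta(v)=\delta((\{v\},\{v\}))$ for $v\in V$. Let $f^{\lambda}(\hat X)=r(t)$ if $X=X^+$ and $X\cap T=\{t\}$ for some $t\in T$, and $f^{\lambda}(\hat X)=0$ otherwise. Let $P(f^{\lambda},u)$ be the set of all $x\in\mathbb{Q}_+^E$ with $x(\delta(\hat X)):=\sum_{e\in\delta(\hat X)}x(e)\ge f^{\lambda}(\hat X)$ for every biset $\hat X$ with $X\neq\emptyset$, and $x(e)\le u(e)$ for every $e\in E$. A point $x\in P(f^{\lambda},u)$ is minimal if no $y\in P(f^{\lambda},u)$ with $y\ne x$ satisfies $y(e)\le x(e)$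 for all $e\in E$. Let $\mathcal{A}$ be the set of (undirected) paths connecting two distinct terminals, $\mathcal{A}_t\subseteq\mathcal{A}$ the set of those with end node $t$, and $E(A)$ the edge set of $A\in\mathcal{A}$. A multiflow is a function $\psi\colon\mathcal{A}\to\mathbb{Q}_+$ with $\sum_{A\in\mathcal{A}\colon e\in E(A)}\psi(A)\le u(e)$ for every $e\in E$ and $\sum_{A\in\mathcal{A}_t}\psi(A)\ge r(t)$ for every $t\in T$; its cost is $\sum_{A\in\mathcal{A}}\psi(A)\sum_{e\in E(A)}c(e)$. The cost of $x\in\mathbb{Q}_+^E$ is $\sum_{e\in E}c(e)x(e)$. Lemma. Let $k$ be a positive integer. (1) For each $1/k$-fractional multiflow $\psi$ there is a $1/k$-fractional vector $x\in P(f^{\lambda},u)$ of the same cost as $\psi$. (2) If $x$ is minimal in $P(f^{\lambda},u)$ and $1/(2k)$-fractional, and $x(\delta(v))$ is $1/k$-fractional for each $v\in V\setminus T$, then there is a $1/(2k)$-fractional multiflow $\psi$ such that $x(e)=\sum_{A\in\mathcal{A}\colon e\in E(A)}\psi(A)$ for every $e\in E$. -/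

import Mathlib

namespace TerminalBackup

/-! An undirected graph with node type `V` and edge type `E` is given by the map `ends : E → Sym2 V`
that sends each edge to its unordered pair of end nodes; parallel edges and loops are allowed. -/

section Graph

variable {V E : Type*}

/-- Walks from a node to a node. -/
inductive Walk (ends : E → Sym2 V) : V → V → Type _
  | nil {v : V} : Walk ends v v
  | cons {v w z : V} (e : E) (h : ends e = s(v, w)) (p : Walk ends w z) : Walk ends v z

/-- The list of nodes visited by a walk, in order. -/
def Walk.support {ends : E → Sym2 V} : {v w : V} → Walk ends v w → List V
  | v, _, .nil => [v]
  | v, _, .cons _ _ p => v :: p.support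

/-- The list of edges traversed by a walk, in order. -/
def Walk.edges {ends : E → Sym2 V} : {v w : V} → Walk ends v w → List E
  | _, _, .nil => []
  | _, _, .cons e _ p => e :: p.edges

/-- A path is a walk that repeats no node. -/
def Walk.IsPath {ends : E → Sym2 V} {v w : V} (p : Walk ends v w) : Prop :=
  p.support.Nodup

/-- `A` is the edge set of a path whose end nodes are `v` and `w`. An undirected path with two
distinct end nodes is determined by its edge set, so such paths are represented by their edge
sets. -/
def IsPathBetween (ends : E → Sym2 V) (v w : V) (A : Finset E) : Prop :=
  ∃ p : Walk ends v w, p.IsPath ∧ ∀ e, e ∈ A ↔ e ∈ p.edges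

/-- `A` is a path that connects `t` to a terminal in `T` other than `t`. -/
def IsTerminalPathAt (ends : E → Sym2 V) (T : Set V) (t : V) (A : Finset E) : Prop :=
  ∃ t' ∈ T, t' ≠ t ∧ IsPathBetween ends t t' A

open Classical in
/-- The set of all paths that connect two distinct terminals. -/
noncomputable def terminalPaths [Fintype E] (ends : E → Sym2 V) (T : Set V) :
    Finset (Finset E) :=
  {A | ∃ t ∈ T, IsTerminalPathAt ends T t A}

end Graph

section Bisets

variable {V E : Type*}

/-- A biset: an inner part contained in an outer part. -/
@[ext]
structure Biset (V : Type*) where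
  inner : Set V
  outer : Set V
  inner_subset_outer : inner ⊆ outer

/-- The neighbor of a biset. -/
def Biset.neighbor (X : Biset V) : Set V := X.outer \ X.inner

/-- The biset `({v}, {v})` identified with the node `v`. -/
def Biset.ofNode (v : V) : Biset V := ⟨{v}, {v}, subset_rfl⟩

open Classical in
/-- The set of edges with one end node in the inner part of `X` and the other outside of the outer
part of `X`. -/
noncomputable def cut [Fintype E] (ends : E → Sym2 V) (X : Biset V) : Finset E :=
  {e | ∃ a ∈ X.inner, ∃ b ∉ X.outer, ends e = s(a, b)}

/-- The family of bisets with nonempty inner part whose inner and outer parts both meet the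
terminal set `T` exactly in `t`. -/
def terminalBisets (T : Set V) (t : V) : Set (Biset V) :=
  {X | X.inner.Nonempty ∧ X.inner ∩ T = {t} ∧ X.outer ∩ T = {t}}

open Classical in
/-- The biset function of the edge-connectivity requirements: `r t` if `X` has an empty neighbor
and belongs to `terminalBisets T t` for a terminal `t` (there is at most one), and `0` otherwise. -/
noncomputable def fLambda (T : Set V) (r : V → ℕ) (X : Biset V) : ℕ :=
  if h : ∃ t ∈ T, X ∈ terminalBisets T t ∧ X.neighbor = ∅ then r h.choose else 0

theorem fLambda_eq {T : Set V} {r : V → ℕ} {X : Biset V} {t : V} (ht : t ∈ T)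
    (hX : X ∈ terminalBisets T t) (hn : X.neighbor = ∅) : fLambda T r X = r t := by
  have h : ∃ t ∈ T, X ∈ terminalBisets T t ∧ X.neighbor = ∅ := ⟨t, ht, hX, hn⟩
  have h1 : h.choose = t :=
    Set.singleton_injective (h.choose_spec.2.1.2.1.symm.trans hX.2.1)
  rw [fLambda, dif_pos h, h1]

theorem fLambda_eq_zero {T : Set V} {r : V → ℕ} {X : Biset V}
    (h : ¬ ∃ t ∈ T, X ∈ terminalBisets T t ∧ X.neighbor = ∅) : fLambda T r X = 0 :=
  dif_neg h

/-- The polyhedron of nonnegative rational vectors `x` with `x(e) ≤ u(e)` for each edge `e` that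
cover the biset function `h`: `x(δ(X)) ≥ h(X)` for each biset `X` with nonempty inner part. -/
def coverPolyhedron [Fintype E] (ends : E → Sym2 V) (h : Biset V → ℕ) (u : E → ℕ) :
    Set (E → ℚ≥0) :=
  {x | (∀ X : Biset V, X.inner.Nonempty → (h X : ℚ≥0) ≤ ∑ e ∈ cut ends X, x e) ∧
    ∀ e, x e ≤ (u e : ℚ≥0)}

end Bisets

section Multiflows

variable {V E : Type*} [Fintype E] {ends : E → Sym2 V} {T : Set V}

open Classical in
/-- The total flow of `ψ` through the edge `e`. -/
noncomputable def load (ψ : terminalPaths ends T → ℚ≥0) (e : E) : ℚ≥0 :=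
  ∑ A : terminalPaths ends T with e ∈ A.1, ψ A

open Classical in
/-- The total flow of `ψ` on paths that connect `t` to other terminals. -/
noncomputable def flowAt (ψ : terminalPaths ends T → ℚ≥0) (t : V) : ℚ≥0 :=
  ∑ A : terminalPaths ends T with IsTerminalPathAt ends T t A.1, ψ A

/-- `ψ` is a multiflow satisfying the edge capacities `u` and the flow demands `r`. -/
def IsMultiflow (u : E → ℕ) (r : V → ℕ) (ψ : terminalPaths ends T → ℚ≥0) : Prop :=
  (∀ e, load ψ e ≤ (u e : ℚ≥0)) ∧ ∀ t ∈ T, (r t : ℚ≥0) ≤ flowAt ψ t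

/-- The cost of a multiflow, where the cost of a path is the sum of the costs of its edges. -/
noncomputable def multiflowCost (c : E → ℚ≥0) (ψ : terminalPaths ends T → ℚ≥0) : ℚ≥0 :=
  ∑ A : terminalPaths ends T, ψ A * ∑ e ∈ A.1, c e

end Multiflows

/-- The number `q` is `1/k`-fractional: `k q` is an integer. -/
def IsFractional (k : ℕ) (q : ℚ≥0) : Prop := ∃ n : ℕ, (k : ℚ≥0) * q = n

end TerminalBackup

/-! The load of a multiflow is a cover, since a path from `t` to another terminal crosses every cut
that isolates `t`.

Conversely, scaling a cover by `2k` gives a multigraph with even degrees outside of `T`. At a node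
`v ∉ T`, each edge `vs` can be split off with some other edge `vw`, replacing both by `sw`, without
violating a cut condition. Otherwise each other edge `vw` is blocked by a side of a tight cut that
contains `s` and `w` but not `v`. By submodularity such sides are closed under union, so some side
of a tight cut contains all neighbors of `v` but not `v`, and adding `v` to it makes a cut that is
too small. Splitting off until all edges join distinct terminals leaves one path of the multiflow
per edge, inside the walk that the edge replaces. The load of this multiflow is at most the original
cover and is itself a cover, so it is equal to a minimal cover. -/

namespace TerminalBackup

section CutSize

variable {V : Type*} {X Y : Set V} {v w : V}

/-- The edge `z` has one end node in `X` and the other outside of `X`. -/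
def Crosses (X : Set V) (z : Sym2 V) : Prop := ∃ a ∈ X, ∃ b ∉ X, z = s(a, b)

theorem crosses_mk : Crosses X s(v, w) ↔ ¬(v ∈ X ↔ w ∈ X) := by
  constructor
  · rintro ⟨a, ha, b, hb, h⟩
    rcases Sym2.eq_iff.1 h with ⟨rfl, rfl⟩ | ⟨rfl, rfl⟩ <;> tauto
  · intro h
    by_cases hv : v ∈ X
    · exact ⟨v, hv, w, by tauto, rfl⟩
    · exact ⟨w, by tauto, v, hv, Sym2.eq_swap⟩

open Classical in
/-- The number of edges of the multigraph with edge multiset `L` that cross `X`. -/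
noncomputable def cutSize (L : Multiset (Sym2 V)) (X : Set V) : ℕ := L.countP (Crosses X)

@[simp]
theorem cutSize_zero (X : Set V) : cutSize 0 X = 0 := by
  simp [cutSize]

open Classical in
theorem cutSize_cons (z : Sym2 V) (L : Multiset (Sym2 V)) (X : Set V) :
    cutSize (z ::ₘ L) X = cutSize L X + if Crosses X z then 1 else 0 :=
  Multiset.countP_cons ..

open Classical in
@[simp]
theorem cutSize_mk_cons (v w : V) (L : Multiset (Sym2 V)) (X : Set V) :
    cutSize (s(v, w) ::ₘ L) X = cutSize L X + if (v ∈ X ↔ w ∈ X) then 0 else 1 := by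
  simp only [cutSize_cons, crosses_mk, ite_not]

theorem cutSize_pos_iff {L : Multiset (Sym2 V)} : 0 < cutSize L X ↔ ∃ z ∈ L, Crosses X z := by
  classical
  exact Multiset.countP_pos

@[simp]
theorem cutSize_empty (L : Multiset (Sym2 V)) : cutSize L ∅ = 0 :=
  Nat.eq_zero_of_not_pos fun h =>
    let ⟨_, _, _, ha, _⟩ := cutSize_pos_iff.1 h
    ha

theorem cutSize_le_of_imp {L : Multiset (Sym2 V)} (h : ∀ z ∈ L, Crosses X z → Crosses Y z) :
    cutSize L X ≤ cutSize L Y := by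
  classical
  induction L using Multiset.induction with
  | empty => simp
  | cons z L ih => grind [cutSize_cons]

theorem cutSize_congr {L : Multiset (Sym2 V)} (h : ∀ z ∈ L, Crosses X z ↔ Crosses Y z) :
    cutSize L X = cutSize L Y := by
  classical
  exact Multiset.countP_congr rfl fun z hz => propext (h z hz)

theorem cutSize_compl (L : Multiset (Sym2 V)) (X : Set V) : cutSize L Xᶜ = cutSize L X :=
  cutSize_congr fun z _ => by
    induction z with | _ a b
    simp only [crosses_mk, Set.mem_compl_iff, not_iff_not]

theorem cutSize_inter_add_union_le (L : Multiset (Sym2 V)) (X Y : Set V) :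
    cutSize L (X ∩ Y) + cutSize L (X ∪ Y) ≤ cutSize L X + cutSize L Y := by
  induction L using Multiset.induction with
  | empty => simp
  | cons z L ih =>
    induction z with | _ a b
    grind [cutSize_mk_cons]

theorem cutSize_inter_add_union_lt {L : Multiset (Sym2 V)} (hL : s(v, w) ∈ L) (hv : v ∈ X \ Y)
    (hw : w ∈ Y \ X) :
    cutSize L (X ∩ Y) + cutSize L (X ∪ Y) < cutSize L X + cutSize L Y := by
  obtain ⟨M, rfl⟩ := Multiset.exists_cons_of_mem hL
  have hM := cutSize_inter_add_union_le M X Y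
  grind [cutSize_mk_cons]

theorem cutSize_sdiff_add_sdiff_le (L : Multiset (Sym2 V)) (X Y : Set V) :
    cutSize L (X \ Y) + cutSize L (Y \ X) ≤ cutSize L X + cutSize L Y := by
  have h := cutSize_inter_add_union_le L X Yᶜ
  rwa [← cutSize_compl L (X ∪ Yᶜ), Set.compl_union, compl_compl, Set.inter_comm Xᶜ,
    ← Set.sdiff_eq, ← Set.sdiff_eq, cutSize_compl] at h

theorem cutSize_sdiff_add_sdiff_lt {L : Multiset (Sym2 V)} (hL : s(v, w) ∈ L) (hv : v ∈ X ∩ Y)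
    (hw : w ∉ X ∪ Y) :
    cutSize L (X \ Y) + cutSize L (Y \ X) < cutSize L X + cutSize L Y := by
  obtain ⟨M, rfl⟩ := Multiset.exists_cons_of_mem hL
  have hM := cutSize_sdiff_add_sdiff_le M X Y
  grind [cutSize_mk_cons]

theorem cutSize_insert_lt {L : Multiset (Sym2 V)} (hL : s(v, w) ∈ L) (hv : v ∉ X)
    (h : ∀ y, s(v, y) ∈ L → y ∈ X) : cutSize L (insert v X) < cutSize L X := by
  have hw : w ∈ X := h w hL
  have hwv : w ≠ v := ne_of_mem_of_not_mem hw hv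
  obtain ⟨M, rfl⟩ := Multiset.exists_cons_of_mem hL
  have hM : cutSize M (insert v X) ≤ cutSize M X := cutSize_le_of_imp fun z hz => by
    induction z with | _ a b
    have ha : a = v → b ∈ X := by
      rintro rfl
      exact h b (Multiset.mem_cons_of_mem hz)
    have hb : b = v → a ∈ X := by
      rintro rfl
      exact h a (Multiset.mem_cons_of_mem (Sym2.eq_swap (a := a) ▸ hz))
    grind [crosses_mk]
  grind [cutSize_mk_cons]

theorem even_cutSize_union_add (L : Multiset (Sym2 V)) (h : Disjoint X Y) :
    Even (cutSize L (X ∪ Y) + (cutSize L X + cutSize L Y)) := by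
  rw [Set.disjoint_left] at h
  induction L using Multiset.induction with
  | empty => simp
  | cons z L ih =>
    induction z with | _ a b
    have ha := @h a
    have hb := @h b
    grind [cutSize_mk_cons]

theorem even_cutSize_of_forall_mem {L : Multiset (Sym2 V)} (h : ∀ v ∈ X, Even (cutSize L {v})) :
    Even (cutSize L X) := by
  classical
  have hfinite : ∀ S : Finset V, ↑S ⊆ X → Even (cutSize L S) := by
    intro S hS
    induction S using Finset.induction_on with
    | empty => simp
    | insert v S hv ih =>
      rw [Finset.coe_insert, Set.insert_subset_iff] at hS
      have hunion :=
        even_cutSize_union_add L (Set.disjoint_singleton_left.2 (mt Finset.mem_coe.1 hv))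
      rw [Finset.coe_insert, Set.insert_eq]
      exact (Nat.even_add.1 hunion).2 ((h v hS.1).add (ih hS.2))
  -- Only the finitely many end nodes of edges of `L` matter.
  let S : Finset V := {v ∈ L.toFinset.biUnion Sym2.toFinset | v ∈ X}
  have hS : cutSize L X = cutSize L S := cutSize_congr fun z hz => by
    have hmem : ∀ v ∈ z, v ∈ (S : Set V) ↔ v ∈ X := fun v hv => by
      have hvL : v ∈ L.toFinset.biUnion Sym2.toFinset :=
        Finset.mem_biUnion.2 ⟨z, Multiset.mem_toFinset.2 hz, Sym2.mem_toFinset.2 hv⟩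
      rw [Finset.mem_coe, Finset.mem_filter, and_iff_right hvL]
    induction z with | _ a b
    rw [crosses_mk, crosses_mk, hmem a (Sym2.mem_mk_left a b), hmem b (Sym2.mem_mk_right a b)]
  rw [hS]
  exact hfinite S fun v hv => (Finset.mem_filter.1 hv).2

end CutSize

section Splitting

variable {V : Type*} {T : Set V} {r : V → ℕ} {L M : Multiset (Sym2 V)} {t t' v w s : V}
  {X Y D D' : Set V}

/-- The multigraph `L` has even degrees outside of `T`, and every cut that isolates a terminal `t`
from the other terminals has at least `r t` edges and the same parity as `r t`. -/
structure Admissible (T : Set V) (r : V → ℕ) (L : Multiset (Sym2 V)) : Prop where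
  even_inner : ∀ v ∉ T, Even (cutSize L {v})
  even_add_cutSize : ∀ t X, X ∩ T = {t} → Even (r t + cutSize L X)
  le_cutSize : ∀ t X, X ∩ T = {t} → r t ≤ cutSize L X

theorem Admissible.of_cons_diag (h : Admissible T r (s(v, v) ::ₘ L)) : Admissible T r L := by
  have hcut : ∀ X, cutSize (s(v, v) ::ₘ L) X = cutSize L X := fun X => by simp
  exact ⟨fun v hv => hcut {v} ▸ h.even_inner v hv,
    fun t X hX => hcut X ▸ h.even_add_cutSize t X hX,
    fun t X hX => hcut X ▸ h.le_cutSize t X hX⟩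

/-- A set isolating the terminal `t` for which the cut condition holds with equality. -/
structure Tight (T : Set V) (r : V → ℕ) (L : Multiset (Sym2 V)) (t : V) (X : Set V) : Prop where
  inter_eq : X ∩ T = {t}
  cutSize_eq : cutSize L X = r t

theorem inter_inter_eq_singleton (hX : X ∩ T = {t}) (hY : Y ∩ T = {t}) : (X ∩ Y) ∩ T = {t} := by
  rw [Set.inter_inter_distrib_right, hX, hY, Set.inter_self]

theorem union_inter_eq_singleton (hX : X ∩ T = {t}) (hY : Y ∩ T = {t}) : (X ∪ Y) ∩ T = {t} := by
  rw [Set.union_inter_distrib_right, hX, hY, Set.union_self]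

theorem sdiff_inter_eq_singleton (htt' : t ≠ t') (hX : X ∩ T = {t}) (hY : Y ∩ T = {t'}) :
    (X \ Y) ∩ T = {t} := by
  rw [Set.inter_sdiff_distrib_right, hX, hY]
  exact sdiff_eq_left.2 (Set.disjoint_singleton.2 htt')

theorem Tight.inter_union (h : Admissible T r L) (hX : Tight T r L t X) (hY : Tight T r L t Y) :
    Tight T r L t (X ∩ Y) ∧ Tight T r L t (X ∪ Y) := by
  have hinter := inter_inter_eq_singleton hX.inter_eq hY.inter_eq
  have hunion := union_inter_eq_singleton hX.inter_eq hY.inter_eq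
  have hsub := cutSize_inter_add_union_le L X Y
  rw [hX.cutSize_eq, hY.cutSize_eq] at hsub
  have hle := h.le_cutSize t _ hinter
  have hle' := h.le_cutSize t _ hunion
  exact ⟨⟨hinter, by omega⟩, ⟨hunion, by omega⟩⟩

theorem Tight.sdiff (h : Admissible T r L) (htt' : t ≠ t') (hX : Tight T r L t X)
    (hY : Tight T r L t' Y) : Tight T r L t (X \ Y) := by
  have hXY := sdiff_inter_eq_singleton htt' hX.inter_eq hY.inter_eq
  have hYX := sdiff_inter_eq_singleton htt'.symm hY.inter_eq hX.inter_eq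
  have hsub := cutSize_sdiff_add_sdiff_le L X Y
  rw [hX.cutSize_eq, hY.cutSize_eq] at hsub
  have hle := h.le_cutSize t _ hXY
  have hle' := h.le_cutSize t' _ hYX
  exact ⟨hXY, by omega⟩

theorem Tight.ne_of_mem_sdiff (h : Admissible T r L) (hX : Tight T r L t X)
    (hY : Tight T r L t' Y) (hL : s(v, w) ∈ L) (hv : v ∈ X \ Y) (hw : w ∈ Y \ X) : t ≠ t' := by
  rintro rfl
  have hsub := cutSize_inter_add_union_lt hL hv hw
  rw [hX.cutSize_eq, hY.cutSize_eq] at hsub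
  have hle := h.le_cutSize t _ (inter_inter_eq_singleton hX.inter_eq hY.inter_eq)
  have hle' := h.le_cutSize t _ (union_inter_eq_singleton hX.inter_eq hY.inter_eq)
  omega

theorem Tight.eq_of_mem_inter (h : Admissible T r L) (hX : Tight T r L t X)
    (hY : Tight T r L t' Y) (hL : s(v, w) ∈ L) (hv : v ∈ X ∩ Y) (hw : w ∉ X ∪ Y) : t = t' := by
  by_contra htt'
  have hsub := cutSize_sdiff_add_sdiff_lt hL hv hw
  rw [hX.cutSize_eq, hY.cutSize_eq] at hsub
  have hle := h.le_cutSize t _ (sdiff_inter_eq_singleton htt' hX.inter_eq hY.inter_eq)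
  have hle' := h.le_cutSize t' _ (sdiff_inter_eq_singleton (Ne.symm htt') hY.inter_eq hX.inter_eq)
  omega

/-- A side of a tight cut: a tight set or the complement of one. Splitting off two edges `vs`, `vw`
decreases exactly the cuts with a side that contains `s` and `w` but not `v`. -/
def IsTightSide (T : Set V) (r : V → ℕ) (L : Multiset (Sym2 V)) (D : Set V) : Prop :=
  ∃ t, Tight T r L t D ∨ Tight T r L t Dᶜ

theorem IsTightSide.union (h : Admissible T r L) (hL : s(v, s) ∈ L) (hD : IsTightSide T r L D)
    (hD' : IsTightSide T r L D') (hv : v ∉ D) (hv' : v ∉ D') (hs : s ∈ D) (hs' : s ∈ D') :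
    IsTightSide T r L (D ∪ D') := by
  obtain ⟨t, hD | hD⟩ := hD <;> obtain ⟨t', hD' | hD'⟩ := hD'
  · obtain rfl := hD.eq_of_mem_inter h hD' (Sym2.eq_swap ▸ hL) ⟨hs, hs'⟩ (by simp [hv, hv'])
    exact ⟨t, .inl (hD.inter_union h hD').2⟩
  · have htt' := hD'.ne_of_mem_sdiff h hD hL ⟨hv', hv⟩ ⟨hs, not_not.2 hs'⟩
    refine ⟨t', .inr ?_⟩
    rw [Set.union_comm, Set.compl_union]
    exact hD'.sdiff h htt' hD
  · have htt' := hD.ne_of_mem_sdiff h hD' hL ⟨hv, hv'⟩ ⟨hs', not_not.2 hs⟩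
    refine ⟨t, .inr ?_⟩
    rw [Set.compl_union]
    exact hD.sdiff h htt' hD'
  · obtain rfl := hD.eq_of_mem_inter h hD' hL ⟨hv, hv'⟩ (by simp [hs, hs'])
    refine ⟨t, .inr ?_⟩
    rw [Set.compl_union]
    exact (hD.inter_union h hD').1

theorem IsTightSide.cutSize_le_insert (h : Admissible T r L) (hD : IsTightSide T r L D)
    (hv : v ∉ T) : cutSize L D ≤ cutSize L (insert v D) := by
  obtain ⟨t, hD | hD⟩ := hD
  · rw [hD.cutSize_eq]
    refine h.le_cutSize t _ ?_
    rw [Set.insert_inter_of_notMem hv, hD.inter_eq]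
  · rw [← cutSize_compl L D, ← cutSize_compl L (insert v D), hD.cutSize_eq]
    refine h.le_cutSize t _ ?_
    rw [← hD.inter_eq]
    grind

theorem Admissible.exists_other_edge (h : Admissible T r (s(v, s) ::ₘ M)) (hv : v ∉ T)
    (hvs : v ≠ s) : ∃ w, s(v, w) ∈ M := by
  have heven := h.even_inner v hv
  have hpos : 0 < cutSize M {v} := by grind [cutSize_mk_cons]
  obtain ⟨z, hz, a, rfl, b, -, rfl⟩ := cutSize_pos_iff.1 hpos
  exact ⟨b, hz⟩

theorem Admissible.exists_splittable (h : Admissible T r (s(v, s) ::ₘ M)) (hv : v ∉ T)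
    (hvs : v ≠ s) :
    ∃ w, s(v, w) ∈ M ∧
      ∀ D, IsTightSide T r (s(v, s) ::ₘ M) D → v ∉ D → s ∈ D → w ∉ D := by
  by_contra! hno
  choose! D hD hvD hsD hwD using hno
  let N : Set V := {w | s(v, w) ∈ M}
  have hfinite : N.Finite := M.finite_toSet.preimage (Sym2.mkEmbedding v).injective.injOn
  have hclosed : SupClosed {D | IsTightSide T r (s(v, s) ::ₘ M) D ∧ v ∉ D ∧ s ∈ D} :=
    fun D ⟨hD, hv, hs⟩ D' ⟨hD', hv', hs'⟩ =>
      ⟨hD.union h (Multiset.mem_cons_self _ _) hD' hv hv' hs hs', by simp [hv, hv'], .inl hs⟩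
  obtain ⟨hside, hvU, hsU⟩ := hclosed.biSup_mem_of_nonempty hfinite (h.exists_other_edge hv hvs)
    fun w hw => ⟨hD w hw, hvD w hw, hsD w hw⟩
  refine (hside.cutSize_le_insert h hv).not_gt
    (cutSize_insert_lt (Multiset.mem_cons_self _ _) hvU fun y hy => ?_)
  obtain hy | hy := Multiset.mem_cons.1 hy
  · rwa [Sym2.congr_right.1 hy]
  · exact Set.mem_biUnion hy (hwD y hy)

theorem Admissible.split {N : Multiset (Sym2 V)}
    (h : Admissible T r (s(v, s) ::ₘ s(v, w) ::ₘ N))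
    (hw : ∀ D, IsTightSide T r (s(v, s) ::ₘ s(v, w) ::ₘ N) D → v ∉ D → s ∈ D → w ∉ D) :
    Admissible T r (s(s, w) ::ₘ N) := by
  have hcut : ∀ X, cutSize (s(s, w) ::ₘ N) X = cutSize (s(v, s) ::ₘ s(v, w) ::ₘ N) X ∨
      cutSize (s(s, w) ::ₘ N) X + 2 = cutSize (s(v, s) ::ₘ s(v, w) ::ₘ N) X ∧
        (v ∉ X ∧ s ∈ X ∧ w ∈ X ∨ v ∉ Xᶜ ∧ s ∈ Xᶜ ∧ w ∈ Xᶜ) := fun X => by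
    grind [cutSize_mk_cons]
  refine ⟨fun y hy => ?_, fun t X hX => ?_, fun t X hX => ?_⟩
  · have heven := h.even_inner y hy
    grind
  · have heven := h.even_add_cutSize t X hX
    grind
  · have hle := h.le_cutSize t X hX
    have heven := h.even_add_cutSize t X hX
    obtain hX' | ⟨hX', hside⟩ := hcut X
    · exact hle.trans_eq hX'.symm
    · have hne : r t ≠ cutSize (s(v, s) ::ₘ s(v, w) ::ₘ N) X := fun htight => by
        obtain ⟨hvX, hsX, hwX⟩ | ⟨hvX, hsX, hwX⟩ := hside
        · exact hw X ⟨t, .inl ⟨hX, htight.symm⟩⟩ hvX hsX hwX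
        · refine hw Xᶜ ⟨t, .inr ?_⟩ hvX hsX hwX
          rw [compl_compl]
          exact ⟨hX, htight.symm⟩
      grind

end Splitting

section Walks

variable {V E : Type*} {ends : E → Sym2 V} {a b c v w s : V} {A : Finset E} {S S' : Multiset E}

namespace Walk

/-- Concatenation of walks. -/
def append : {a b c : V} → Walk ends a b → Walk ends b c → Walk ends a c
  | _, _, _, .nil, q => q
  | _, _, _, .cons e h p, q => .cons e h (p.append q)

/-- The walk traversed backwards. -/
def reverse : {a b : V} → Walk ends a b → Walk ends b a
  | _, _, .nil => .nil
  | _, _, .cons e h p => p.reverse.append (.cons e (h.trans Sym2.eq_swap) .nil)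

theorem edges_append (p : Walk ends a b) (q : Walk ends b c) :
    (p.append q).edges = p.edges ++ q.edges := by
  induction p with
  | nil => rfl
  | cons e _ _ ih => exact congrArg (e :: ·) (ih q)

theorem support_append (p : Walk ends a b) (q : Walk ends b c) :
    (p.append q).support = p.support ++ q.support.tail := by
  induction p with
  | nil => cases q <;> rfl
  | @cons v _ _ _ _ _ ih => exact congrArg (v :: ·) (ih q)

theorem edges_reverse (p : Walk ends a b) : p.reverse.edges = p.edges.reverse := by
  induction p with
  | nil => rfl
  | cons _ _ _ ih => simp only [reverse, edges_append, edges, ih, List.reverse_cons]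

theorem support_reverse (p : Walk ends a b) : p.reverse.support = p.support.reverse := by
  induction p with
  | nil => rfl
  | cons _ _ _ ih =>
    simp only [reverse, support_append, support, ih, List.reverse_cons, List.tail_cons]

theorem IsPath.reverse {p : Walk ends a b} (hp : p.IsPath) : p.reverse.IsPath := by
  rw [IsPath, support_reverse]
  exact List.nodup_reverse.2 hp

theorem exists_suffix (p : Walk ends a b) (hv : v ∈ p.support) :
    ∃ q : Walk ends v b, q.support <:+ p.support ∧ q.edges <:+ p.edges := by
  induction p with
  | nil =>
    obtain rfl := List.mem_singleton.1 hv
    exact ⟨.nil, List.suffix_rfl, List.suffix_rfl⟩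
  | cons e h p ih =>
    obtain rfl | hv := List.mem_cons.1 hv
    · exact ⟨.cons e h p, List.suffix_rfl, List.suffix_rfl⟩
    · obtain ⟨q, hsupport, hedges⟩ := ih hv
      exact ⟨q, hsupport.trans (List.suffix_cons _ _), hedges.trans (List.suffix_cons _ _)⟩

theorem exists_isPath (p : Walk ends a b) :
    ∃ q : Walk ends a b, q.IsPath ∧ q.edges ⊆ p.edges := by
  induction p with
  | nil => exact ⟨.nil, List.nodup_singleton _, List.Subset.refl _⟩
  | @cons v _ _ e h p ih =>
    obtain ⟨q, hq, hqp⟩ := ih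
    by_cases hv : v ∈ q.support
    · obtain ⟨q', hsupport, hedges⟩ := q.exists_suffix hv
      exact ⟨q', hq.sublist hsupport.sublist,
        List.subset_cons_of_subset _ (List.Subset.trans hedges.subset hqp)⟩
    · exact ⟨.cons e h q, List.nodup_cons.2 ⟨hv, hq⟩, List.cons_subset_cons _ hqp⟩

theorem exists_crosses {X : Set V} (p : Walk ends a b) (ha : a ∈ X) (hb : b ∉ X) :
    ∃ e ∈ p.edges, Crosses X (ends e) := by
  induction p with
  | nil => exact absurd ha hb
  | @cons v w _ e h p ih =>
    by_cases hw : w ∈ X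
    · obtain ⟨e', he', hcross⟩ := ih hw hb
      exact ⟨e', List.mem_cons_of_mem _ he', hcross⟩
    · exact ⟨e, List.mem_cons_self, v, ha, w, hw, h⟩

end Walk

theorem IsPathBetween.symm (h : IsPathBetween ends a b A) : IsPathBetween ends b a A := by
  obtain ⟨p, hp, hA⟩ := h
  exact ⟨p.reverse, hp.reverse, fun e => by rw [hA, Walk.edges_reverse, List.mem_reverse]⟩

/-- `S` is the multiset of edges traversed by a walk between the two end nodes in `z`. It labels an
edge `z` obtained by splitting off with the original edges that it replaces. -/
def IsTrace (ends : E → Sym2 V) (z : Sym2 V) (S : Multiset E) : Prop :=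
  ∃ a b, z = s(a, b) ∧ ∃ p : Walk ends a b, (p.edges : Multiset E) = S

theorem isTrace_singleton (ends : E → Sym2 V) (e : E) : IsTrace ends (ends e) {e} := by
  induction h : ends e with | _ a b
  exact ⟨a, b, rfl, .cons e h .nil, rfl⟩

theorem IsTrace.exists_walk (h : IsTrace ends s(a, b) S) :
    ∃ p : Walk ends a b, (p.edges : Multiset E) = S := by
  obtain ⟨a', b', hz, p, hp⟩ := h
  obtain ⟨rfl, rfl⟩ | ⟨rfl, rfl⟩ := Sym2.eq_iff.1 hz
  · exact ⟨p, hp⟩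
  · exact ⟨p.reverse, by rw [Walk.edges_reverse, Multiset.coe_reverse, hp]⟩

theorem IsTrace.add (h : IsTrace ends s(v, s) S) (h' : IsTrace ends s(v, w) S') :
    IsTrace ends s(s, w) (S + S') := by
  rw [Sym2.eq_swap] at h
  obtain ⟨p, rfl⟩ := h.exists_walk
  obtain ⟨q, rfl⟩ := h'.exists_walk
  exact ⟨s, w, rfl, p.append q, by rw [Walk.edges_append, Multiset.coe_add]⟩

theorem IsTrace.exists_isPathBetween (h : IsTrace ends s(a, b) S) :
    ∃ A : Finset E, IsPathBetween ends a b A ∧ ∀ e ∈ A, e ∈ S := by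
  classical
  obtain ⟨p, rfl⟩ := h.exists_walk
  obtain ⟨q, hq, hqp⟩ := p.exists_isPath
  exact ⟨q.edges.toFinset, ⟨q, hq, fun e => List.mem_toFinset⟩,
    fun e he => hqp (List.mem_toFinset.1 he)⟩

end Walks

section Packing

variable {V E : Type*} {ends : E → Sym2 V} {T : Set V} {r : V → ℕ}
  {L : Multiset (Sym2 V × Multiset E)}

open Classical in
/-- `K` is an integral multiflow: a multiset of paths between distinct terminals that respects the
edge capacities `n` and has at least `r t` paths ending at each terminal `t`. -/
structure IsPathPacking [Fintype E] (n : E → ℕ) (r : V → ℕ)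
    (K : Multiset (terminalPaths ends T)) : Prop where
  countP_mem_le : ∀ e, K.countP (e ∈ ·.1) ≤ n e
  le_countP_terminal : ∀ t ∈ T, r t ≤ K.countP (IsTerminalPathAt ends T t ·.1)

theorem IsPathPacking.mono [Fintype E] {n n' : E → ℕ} {r' : V → ℕ}
    {K : Multiset (terminalPaths ends T)} (hK : IsPathPacking n r K) (hn : ∀ e, n e ≤ n' e)
    (hr : ∀ t ∈ T, r' t ≤ r t) :
    IsPathPacking n' r' K :=
  ⟨fun e => (hK.countP_mem_le e).trans (hn e),
    fun t ht => (hr t ht).trans (hK.le_countP_terminal t ht)⟩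

open Classical in
theorem exists_isPathPacking_of_forall_mem [Fintype E]
    (htrace : ∀ z ∈ L, IsTrace ends z.1 z.2) (hdiag : ∀ z ∈ L, ¬z.1.IsDiag)
    (hT : ∀ z ∈ L, ∀ v ∈ z.1, v ∈ T) :
    ∃ K : Multiset (terminalPaths ends T), IsPathPacking (fun e => (L.map Prod.snd).sum.count e)
      (fun t => cutSize (L.map Prod.fst) {t}) K := by
  induction L using Multiset.induction with
  | empty => exact ⟨0, by simp, by simp⟩
  | cons z L ih =>
    rw [Multiset.forall_mem_cons] at htrace hdiag hT
    obtain ⟨K, hK⟩ := ih htrace.2 hdiag.2 hT.2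
    obtain ⟨⟨a, b⟩, S⟩ := z
    have hab : a ≠ b := hdiag.1
    have ha : a ∈ T := hT.1 a (Sym2.mem_mk_left a b)
    have hb : b ∈ T := hT.1 b (Sym2.mem_mk_right a b)
    obtain ⟨A, hA, hAS⟩ := htrace.1.exists_isPathBetween
    have hAa : IsTerminalPathAt ends T a A := ⟨b, hb, hab.symm, hA⟩
    have hAb : IsTerminalPathAt ends T b A := ⟨a, ha, hab, hA.symm⟩
    refine ⟨⟨A, by simpa [terminalPaths] using ⟨a, ha, hAa⟩⟩ ::ₘ K, fun e => ?_, fun t ht => ?_⟩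
    · have hle := hK.countP_mem_le e
      have hcount : (if e ∈ A then 1 else 0) ≤ S.count e := by
        split_ifs with he
        exacts [Multiset.one_le_count_iff_mem.2 (hAS e he), Nat.zero_le _]
      rw [Multiset.countP_cons, Multiset.map_cons, Multiset.sum_cons, Multiset.count_add, add_comm]
      exact add_le_add hcount hle
    · have hle := hK.le_countP_terminal t ht
      have hcross : (a ∈ ({t} : Set V) ↔ b ∈ ({t} : Set V)) ∨ IsTerminalPathAt ends T t A := by
        by_cases hta : a = t
        · exact .inr (hta ▸ hAa)
        · by_cases htb : b = t
          · exact .inr (htb ▸ hAb)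
          · exact .inl (iff_of_false hta htb)
      rw [Multiset.countP_cons, Multiset.map_cons]
      change cutSize (s(a, b) ::ₘ L.map Prod.fst) {t} ≤ _
      grind [cutSize_mk_cons]

theorem Admissible.exists_card_lt (h : Admissible T r (L.map Prod.fst))
    (htrace : ∀ z ∈ L, IsTrace ends z.1 z.2)
    (hred : ∃ z ∈ L, z.1.IsDiag ∨ ∃ v ∈ z.1, v ∉ T) :
    ∃ L' : Multiset (Sym2 V × Multiset E), L'.card < L.card ∧ Admissible T r (L'.map Prod.fst) ∧
      (∀ z ∈ L', IsTrace ends z.1 z.2) ∧ (L'.map Prod.snd).sum ≤ (L.map Prod.snd).sum := by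
  obtain ⟨⟨z, S⟩, hz, hred⟩ := hred
  obtain ⟨M, rfl⟩ := Multiset.exists_cons_of_mem hz
  rw [Multiset.map_cons] at h
  rw [Multiset.forall_mem_cons] at htrace
  by_cases hdiag : z.IsDiag
  · induction z with | _ a b
    obtain rfl : a = b := hdiag
    refine ⟨M, by simp, h.of_cons_diag, htrace.2, ?_⟩
    rw [Multiset.map_cons, Multiset.sum_cons]
    exact Multiset.le_add_left _ _
  · obtain ⟨v, ⟨s, rfl⟩, hv⟩ := hred.resolve_left hdiag
    obtain ⟨w, hw, hsplittable⟩ := h.exists_splittable hv hdiag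
    obtain ⟨⟨_, S'⟩, hy, rfl⟩ := Multiset.mem_map.1 hw
    obtain ⟨N, rfl⟩ := Multiset.exists_cons_of_mem hy
    rw [Multiset.forall_mem_cons] at htrace
    rw [Multiset.map_cons] at h hsplittable
    refine ⟨(s(s, w), S + S') ::ₘ N, by simp, ?_, ?_, ?_⟩
    · rw [Multiset.map_cons]
      exact h.split hsplittable
    · exact Multiset.forall_mem_cons.2 ⟨htrace.1.add htrace.2.1, htrace.2.2⟩
    · simp only [Multiset.map_cons, Multiset.sum_cons, add_assoc, le_refl]

open Classical in
/-- The Lovász–Cherkassky theorem, for a multigraph whose edges are labelled with their traces in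
the original graph. -/
theorem Admissible.exists_isPathPacking [Fintype E] (h : Admissible T r (L.map Prod.fst))
    (htrace : ∀ z ∈ L, IsTrace ends z.1 z.2) :
    ∃ K : Multiset (terminalPaths ends T),
      IsPathPacking (fun e => (L.map Prod.snd).sum.count e) r K := by
  induction hn : L.card using Nat.strong_induction_on generalizing L with | _ n ih
  subst hn
  by_cases hred : ∃ z ∈ L, z.1.IsDiag ∨ ∃ v ∈ z.1, v ∉ T
  · obtain ⟨L', hcard, h', htrace', hsum⟩ := h.exists_card_lt htrace hred
    obtain ⟨K, hK⟩ := ih _ hcard h' htrace' rfl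
    exact ⟨K, hK.mono (fun e => Multiset.count_le_of_le e hsum) fun _ _ => le_rfl⟩
  · push Not at hred
    obtain ⟨K, hK⟩ := exists_isPathPacking_of_forall_mem htrace (fun z hz => (hred z hz).1)
      fun z hz => (hred z hz).2
    refine ⟨K, hK.mono (fun _ => le_rfl) fun t ht => h.le_cutSize t {t} ?_⟩
    exact Set.singleton_inter_of_mem ht

end Packing

section EdgeCopies

variable {V E : Type*} [Fintype E] {ends : E → Sym2 V}

/-- The biset `(X, X)` identified with the node set `X`. -/
def Biset.ofSet (X : Set V) : Biset V := ⟨X, X, subset_rfl⟩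

open Classical in
theorem cut_ofSet (X : Set V) :
    cut ends (Biset.ofSet X) = ({e | Crosses X (ends e)} : Finset E) :=
  rfl

/-- The multigraph with `n e` copies of each edge `e`, each labelled by its trace `{e}`. -/
def edgeCopies (ends : E → Sym2 V) (n : E → ℕ) : Multiset (Sym2 V × Multiset E) :=
  Finset.univ.val.bind fun e => Multiset.replicate (n e) (ends e, {e})

theorem isTrace_of_mem_edgeCopies {n : E → ℕ} {z : Sym2 V × Multiset E}
    (hz : z ∈ edgeCopies ends n) : IsTrace ends z.1 z.2 := by
  obtain ⟨e, -, he⟩ := Multiset.mem_bind.1 hz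
  obtain rfl := Multiset.eq_of_mem_replicate he
  exact isTrace_singleton ends e

theorem cutSize_edgeCopies (n : E → ℕ) (X : Set V) :
    cutSize ((edgeCopies ends n).map Prod.fst) X = ∑ e ∈ cut ends (Biset.ofSet X), n e := by
  rw [cut_ofSet, Finset.sum_filter, cutSize, edgeCopies]
  simp [Multiset.map_bind, Multiset.countP_eq_card_filter, Multiset.filter_bind, Multiset.map_nsmul,
    ← Multiset.nsmul_singleton, Multiset.filter_nsmul, Multiset.filter_singleton, apply_ite]

theorem count_sum_map_snd_edgeCopies [DecidableEq E] (n : E → ℕ) (e : E) :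
    ((edgeCopies ends n).map Prod.snd).sum.count e = n e := by
  have hsum : ((edgeCopies ends n).map Prod.snd).sum = ∑ e, n e • {e} := by
    simp [edgeCopies, Multiset.map_bind, Multiset.sum_bind]
  simp [hsum, Multiset.count_sum', Multiset.count_singleton]

open Classical in
theorem exists_isPathPacking_of_cover {T : Set V} {r : V → ℕ} (n : E → ℕ)
    (heven : ∀ v ∉ T, Even (∑ e ∈ cut ends (Biset.ofSet {v}), n e))
    (hcover : ∀ t X, X ∩ T = {t} → r t ≤ ∑ e ∈ cut ends (Biset.ofSet X), n e) :
    ∃ K : Multiset (terminalPaths ends T), IsPathPacking n r K := by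
  simp only [← cutSize_edgeCopies] at heven hcover
  set L := (edgeCopies ends n).map Prod.fst
  -- All cuts isolating `t` have the same parity, to which the requirement of `t` can be rounded up.
  have heven_add : ∀ t X, X ∩ T = {t} → Even (cutSize L X + cutSize L {t}) := fun t X hX => by
    have htX : t ∈ X := (hX.ge rfl).1
    have hdiff : Even (cutSize L (X \ {t})) :=
      even_cutSize_of_forall_mem fun v hv => heven v fun hvT => hv.2 (hX.le ⟨hv.1, hvT⟩)
    have hunion := even_cutSize_union_add L (Set.disjoint_sdiff_right (s := {t}) (t := X))
    rw [Set.union_sdiff_cancel (Set.singleton_subset_iff.2 htX)] at hunion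
    grind
  have hadmissible : Admissible T (fun t => r t + (r t + cutSize L {t}) % 2) L := by
    refine ⟨heven, fun t X hX => ?_, fun t X hX => ?_⟩ <;>
    · have hle := hcover t X hX
      have hpar := heven_add t X hX
      grind
  obtain ⟨K, hK⟩ := hadmissible.exists_isPathPacking fun z hz => isTrace_of_mem_edgeCopies hz
  exact ⟨K, hK.mono (fun e => (count_sum_map_snd_edgeCopies n e).le)
    fun t _ => Nat.le_add_right _ _⟩

end EdgeCopies

section Multiflows

variable {V E : Type*} [Fintype E] {ends : E → Sym2 V} {T : Set V} {r : V → ℕ} {u : E → ℕ}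
  {ψ : terminalPaths ends T → ℚ≥0}

theorem mem_coverPolyhedron_fLambda_iff {x : E → ℚ≥0} :
    x ∈ coverPolyhedron ends (fLambda T r) u ↔
      (∀ t X, X ∩ T = {t} → (r t : ℚ≥0) ≤ ∑ e ∈ cut ends (Biset.ofSet X), x e) ∧
        ∀ e, x e ≤ u e := by
  refine and_congr_left fun _ => ⟨fun h t X hX => ?_, fun h X _ => ?_⟩
  · obtain ⟨htX, htT⟩ := hX.ge rfl
    have hle := h (Biset.ofSet X) ⟨t, htX⟩
    rwa [fLambda_eq htT ⟨⟨t, htX⟩, hX, hX⟩ Set.sdiff_self] at hle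
  · by_cases hX : ∃ t ∈ T, X ∈ terminalBisets T t ∧ X.neighbor = ∅
    · obtain ⟨t, ht, hXt, hneighbor⟩ := hX
      have hset : X = Biset.ofSet X.inner :=
        Biset.ext rfl ((Set.sdiff_eq_empty.1 hneighbor).antisymm X.inner_subset_outer)
      rw [fLambda_eq ht hXt hneighbor, hset]
      exact h t X.inner hXt.2.1
    · rw [fLambda_eq_zero hX, Nat.cast_zero]
      exact zero_le

theorem IsTerminalPathAt.exists_mem_cut {t : V} {A : Finset E} {X : Set V}
    (hA : IsTerminalPathAt ends T t A) (hX : X ∩ T = {t}) :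
    ∃ e ∈ A, e ∈ cut ends (Biset.ofSet X) := by
  obtain ⟨t', ht', htt', p, -, hp⟩ := hA
  obtain ⟨e, he, hcross⟩ := p.exists_crosses (hX.ge rfl).1 fun h => htt' (hX.le ⟨h, ht'⟩)
  exact ⟨e, (hp e).2 he, by simpa only [cut_ofSet, Finset.mem_filter_univ]⟩

theorem flowAt_le_sum_cut {t : V} {X : Set V} (hX : X ∩ T = {t}) :
    flowAt ψ t ≤ ∑ e ∈ cut ends (Biset.ofSet X), load ψ e := by
  classical
  simp only [flowAt, load, Finset.sum_filter]
  rw [Finset.sum_comm]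
  refine Finset.sum_le_sum fun A _ => ?_
  split_ifs with hA
  · obtain ⟨e, he, heX⟩ := hA.exists_mem_cut hX
    calc ψ A = if e ∈ A.1 then ψ A else 0 := (if_pos he).symm
      _ ≤ _ := Finset.single_le_sum (f := fun e => if e ∈ A.1 then ψ A else 0)
        (fun _ _ => zero_le) heX
  · exact zero_le

theorem IsMultiflow.load_mem_coverPolyhedron (h : IsMultiflow u r ψ) :
    load ψ ∈ coverPolyhedron ends (fLambda T r) u :=
  mem_coverPolyhedron_fLambda_iff.2
    ⟨fun t _ hX => (h.2 t (hX.ge rfl).2).trans (flowAt_le_sum_cut hX), h.1⟩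

theorem sum_mul_load (c : E → ℚ≥0) (ψ : terminalPaths ends T → ℚ≥0) :
    ∑ e, c e * load ψ e = multiflowCost c ψ := by
  classical
  simp only [load, multiflowCost, Finset.mul_sum, Finset.sum_filter]
  rw [Finset.sum_comm]
  refine Finset.sum_congr rfl fun A _ => ?_
  simp [mul_comm]

theorem IsFractional.sum {ι : Type*} {k : ℕ} {s : Finset ι} {f : ι → ℚ≥0}
    (h : ∀ i ∈ s, IsFractional k (f i)) : IsFractional k (∑ i ∈ s, f i) := by
  choose! n hn using h
  refine ⟨∑ i ∈ s, n i, ?_⟩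
  rw [Finset.mul_sum, Nat.cast_sum]
  exact Finset.sum_congr rfl hn

open Classical in
/-- The multiflow that sends `1 / m` units of flow along each path of the packing `K`. -/
noncomputable def flowOfPacking (m : ℕ) (K : Multiset (terminalPaths ends T)) :
    terminalPaths ends T → ℚ≥0 :=
  fun A => K.count A / m

theorem isFractional_flowOfPacking {m : ℕ} (hm : 0 < m) (K : Multiset (terminalPaths ends T))
    (A : terminalPaths ends T) : IsFractional m (flowOfPacking m K A) :=
  ⟨_, mul_div_cancel₀ _ (Nat.cast_ne_zero.2 hm.ne')⟩

theorem mul_sum_flowOfPacking {m : ℕ} (hm : 0 < m) (K : Multiset (terminalPaths ends T))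
    (p : terminalPaths ends T → Prop) [DecidablePred p] :
    m * ∑ A with p A, flowOfPacking m K A = K.countP p := by
  classical
  have hcount : ∑ A with p A, K.count A = K.countP p := by
    simp only [Finset.sum_filter, ← Multiset.count_filter]
    rw [Multiset.sum_count_eq_card fun A _ => Finset.mem_univ A, Multiset.countP_eq_card_filter]
  simp only [flowOfPacking]
  rw [← Finset.sum_div, ← Nat.cast_sum, hcount, mul_div_cancel₀ _ (Nat.cast_ne_zero.2 hm.ne')]

variable {m : ℕ} {n : E → ℕ} {K : Multiset (terminalPaths ends T)}

theorem IsPathPacking.mul_load_flowOfPacking_le (hK : IsPathPacking n r K) (hm : 0 < m) (e : E) :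
    m * load (flowOfPacking m K) e ≤ n e := by
  rw [load, mul_sum_flowOfPacking hm]
  exact_mod_cast hK.countP_mem_le e

theorem IsPathPacking.le_mul_flowAt_flowOfPacking (hK : IsPathPacking n r K) (hm : 0 < m) {t : V}
    (ht : t ∈ T) : (r t : ℚ≥0) ≤ m * flowAt (flowOfPacking m K) t := by
  rw [flowAt, mul_sum_flowOfPacking hm]
  exact_mod_cast hK.le_countP_terminal t ht

theorem exists_multiflow_load_le {x : E → ℚ≥0} {k : ℕ} (hk : 0 < k)
    (hx : x ∈ coverPolyhedron ends (fLambda T r) u) (hfrac : ∀ e, IsFractional (2 * k) (x e))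
    (hinner : ∀ v ∉ T, IsFractional k (∑ e ∈ cut ends (Biset.ofSet {v}), x e)) :
    ∃ ψ : terminalPaths ends T → ℚ≥0, IsMultiflow u r ψ ∧ (∀ A, IsFractional (2 * k) (ψ A)) ∧
      load ψ ≤ x := by
  rw [mem_coverPolyhedron_fLambda_iff] at hx
  choose n hn using hfrac
  have hm : 0 < 2 * k := Nat.mul_pos two_pos hk
  have hm' : (0 : ℚ≥0) < (2 * k : ℕ) := Nat.cast_pos.2 hm
  have hsum : ∀ s : Finset E, ((∑ e ∈ s, n e : ℕ) : ℚ≥0) = (2 * k : ℕ) * ∑ e ∈ s, x e := by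
    intro s
    rw [Nat.cast_sum, Finset.mul_sum]
    exact Finset.sum_congr rfl fun e _ => (hn e).symm
  have heven : ∀ v ∉ T, Even (∑ e ∈ cut ends (Biset.ofSet {v}), n e) := fun v hv => by
    obtain ⟨j, hj⟩ := hinner v hv
    refine even_iff_two_dvd.2 ⟨j, Nat.cast_injective (R := ℚ≥0) ?_⟩
    rw [hsum, Nat.cast_mul, mul_assoc, hj, Nat.cast_mul]
  have hcover : ∀ t X, X ∩ T = {t} →
      2 * k * r t ≤ ∑ e ∈ cut ends (Biset.ofSet X), n e := fun t X hX => by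
    rw [← Nat.cast_le (α := ℚ≥0), hsum, Nat.cast_mul]
    gcongr
    exact hx.1 t X hX
  obtain ⟨K, hK⟩ := exists_isPathPacking_of_cover (r := fun t => 2 * k * r t) n heven hcover
  have hload : load (flowOfPacking (2 * k) K) ≤ x := fun e =>
    le_of_mul_le_mul_left ((hK.mul_load_flowOfPacking_le hm e).trans_eq (hn e).symm) hm'
  refine ⟨flowOfPacking (2 * k) K, ⟨fun e => (hload e).trans (hx.2 e), fun t ht => ?_⟩,
    isFractional_flowOfPacking hm K, hload⟩
  refine le_of_mul_le_mul_left ?_ hm'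
  exact_mod_cast hK.le_mul_flowAt_flowOfPacking hm ht

end Multiflows

end TerminalBackup

theorem mainTheorem6_general {V E : Type*} [Fintype E] (ends : E → Sym2 V)
    (c : E → ℚ≥0) (u : E → ℕ) (T : Set V) (r : V → ℕ) (k : ℕ) (hk : 0 < k) :
    (∀ ψ : TerminalBackup.terminalPaths ends T → ℚ≥0,
      TerminalBackup.IsMultiflow u r ψ →
      (∀ A, TerminalBackup.IsFractional k (ψ A)) →
      ∃ x ∈ TerminalBackup.coverPolyhedron ends (TerminalBackup.fLambda T r) u,
        (∀ e, TerminalBackup.IsFractional k (x e)) ∧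
        ∑ e, c e * x e = TerminalBackup.multiflowCost c ψ) ∧
    (∀ x : E → ℚ≥0,
      Minimal (fun y => y ∈ TerminalBackup.coverPolyhedron ends
        (TerminalBackup.fLambda T r) u) x →
      (∀ e, TerminalBackup.IsFractional (2 * k) (x e)) →
      (∀ v ∉ T, TerminalBackup.IsFractional k
        (∑ e ∈ TerminalBackup.cut ends (TerminalBackup.Biset.ofNode v), x e)) →
      ∃ ψ : TerminalBackup.terminalPaths ends T → ℚ≥0,
        TerminalBackup.IsMultiflow u r ψ ∧
        (∀ A, TerminalBackup.IsFractional (2 * k) (ψ A)) ∧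
        ∀ e, x e = TerminalBackup.load ψ e) := by
  refine ⟨fun ψ hψ hfrac => ?_, fun x hx hfrac hinner => ?_⟩
  · exact ⟨TerminalBackup.load ψ, hψ.load_mem_coverPolyhedron,
      fun e => TerminalBackup.IsFractional.sum fun A _ => hfrac A,
      TerminalBackup.sum_mul_load c ψ⟩
  · obtain ⟨ψ, hψ, hψfrac, hload⟩ :=
      TerminalBackup.exists_multiflow_load_le hk hx.prop hfrac hinner
    have heq : x = TerminalBackup.load ψ := hx.eq_of_ge hψ.load_mem_coverPolyhedron hload
    exact ⟨ψ, hψ, hψfrac, congrFun heq⟩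

theorem mainTheorem6 {V E : Type*} [Finite V] [Fintype E] (ends : E → Sym2 V)
    (c : E → ℚ≥0) (u : E → ℕ) (T : Set V) (r : V → ℕ) (k : ℕ) (hk : 0 < k) :
    (∀ ψ : TerminalBackup.terminalPaths ends T → ℚ≥0,
      TerminalBackup.IsMultiflow u r ψ →
      (∀ A, TerminalBackup.IsFractional k (ψ A)) →
      ∃ x ∈ TerminalBackup.coverPolyhedron ends (TerminalBackup.fLambda T r) u,
        (∀ e, TerminalBackup.IsFractional k (x e)) ∧
        ∑ e, c e * x e = TerminalBackup.multiflowCost c ψ) ∧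
    (∀ x : E → ℚ≥0,
      Minimal (fun y => y ∈ TerminalBackup.coverPolyhedron ends
        (TerminalBackup.fLambda T r) u) x →
      (∀ e, TerminalBackup.IsFractional (2 * k) (x e)) →
      (∀ v ∉ T, TerminalBackup.IsFractional k
        (∑ e ∈ TerminalBackup.cut ends (TerminalBackup.Biset.ofNode v), x e)) →
      ∃ ψ : TerminalBackup.terminalPaths ends T → ℚ≥0,
        TerminalBackup.IsMultiflow u r ψ ∧
        (∀ A, TerminalBackup.IsFractional (2 * k) (ψ A)) ∧
        ∀ e, x e = TerminalBackup.load ψ e) :=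
  mainTheorem6_general ends c u T r k hk
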